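/- Theorem 1. Let $M,N$ be the numbers of base-station (BS) antennas and of elements of a reconfigurable intelligent surface (RIS), let $\beta_d,\beta_{br},\beta_{ru}\ge 0$ be link gains, and let $\bar\tau=E_s/\sigma^2$ with $E_s\ge 0$ and $\sigma>0$. Let $R_d\in\mathbb C^{M\times M}$ and $R_{ru}\in\mathbb C^{N\times N}$ be correlation matrices (Hermitian positive semidefinite with unit diagonal), with positive semidefinite square roots $R_d^{1/2},R_{ru}^{1/2}$, and put $\rho_{ij}=(R_{ru})_{ij}$. Let $a_b\in\mathbb C^M$ and $a_r\in\mathbb C^N$ be steering vectors, with $\|a_b\|_2=\sqrt M$ and $|a_{r,n}|=1$ for all $n$. Let $u_d\sim\mathcal{CN}(0,I_M)$ and $u_{ru}\sim\mathcal{CN}(0,I_N)$ be independent, and set $$h_d=\sqrt{\beta_d}\,R_d^{1/2}u_d,\qquad h_{ru}=\sqrt{\beta_{ru}}\,R_{ru}^{1/2}u_{ru},\qquad H_{br}=\sqrt{\beta_{br}}\,a_ba_r^H.$$ For a diagonal matrix $\Phi=\mathrm{diag}(e^{j\phi_1},\dots,e^{j\phi_N})$ with real $\phi_1,\dots,\phi_N$,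 let $h=h_d+H_{br}\Phi h_{ru}$; the uplink signal-to-noise ratio is $\mathrm{SNR}=h^Hh\,\bar\tau$. For every realisation of the channels it is maximised over all such $\Phi$ by $$\Phi=e^{j\angle(a_b^Hh_d)}\,\mathrm{diag}(e^{j\angle a_r})\,\mathrm{diag}(e^{-j\angle h_{ru}})\qquad(\angle 0:=0).$$ With this choice of $\Phi$, $\mathrm{SNR}$ is integrable and $$\mathbb E\{\mathrm{SNR}\}=\Big(\beta_dM+\frac{NA\pi\sqrt{\beta_d\beta_{br}\beta_{ru}}}{2}+\beta_{br}\beta_{ru}M(N+F)\Big)\bar\tau,$$ where $A=\|R_d^{1/2}a_b\|_2$ and $$F=\sum_{\substack{i,j=1\\ i\ne j}}^{N}\frac{\pi}{4}\big(1-|\rho_{ij}|^2\big)^2\,{}_2F_1\Big(\tfrac32,\tfrac32;1;|\rho_{ij}|^2\Big);$$ here a summand with $|\rho_{ij}|=1$ is read as its limit as $|\rho_{ij}|\uparrow 1$, which exists and equals $1$. -/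

import Mathlib

open MeasureTheory ProbabilityTheory Filter Topology
open scoped Matrix MatrixOrder ComplexOrder

noncomputable section

namespace RIS

/-- A correlation matrix: Hermitian positive semidefinite with unit diagonal. -/
structure IsCorrelationMatrix {n : ℕ} (R : Matrix (Fin n) (Fin n) ℂ) : Prop where
  posSemidef : R.PosSemidef
  diag_eq_one : ∀ i, R i i = 1

/-- The circularly symmetric law `CN(0, 1)` on `ℂ`: real and imaginary parts are independent real
Gaussians with mean `0` and variance `1/2`. -/
def stdComplexNormal : Measure ℂ :=
  ((gaussianReal 0 (1 / 2)).prod (gaussianReal 0 (1 / 2))).map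
    (fun p : ℝ × ℝ => (⟨p.1, p.2⟩ : ℂ))

/-- The law `CN(0, I)` on `ℂⁿ`: the coordinates are independent with law `CN(0, 1)`. -/
def stdComplexNormalVec (n : ℕ) : Measure (Fin n → ℂ) :=
  Measure.pi fun _ => stdComplexNormal

/-- A correlated Rayleigh channel `√β R^{1/2} u`, where `R^{1/2}` is the positive semidefinite
square root of `R`. -/
def rayleighChannel {n : ℕ} (β : ℝ) (R : Matrix (Fin n) (Fin n) ℂ) (u : Fin n → ℂ) : Fin n → ℂ :=
  √β • (CFC.sqrt R *ᵥ u)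

/-- The rank-one line-of-sight RIS–BS channel `√β a_b a_rᴴ`. -/
def losChannel {M N : ℕ} (β : ℝ) (ab : Fin M → ℂ) (ar : Fin N → ℂ) : Matrix (Fin M) (Fin N) ℂ :=
  √β • Matrix.vecMulVec ab (star ar)

/-- The diagonal matrix of reflection coefficients `exp(j φ_r)`. -/
def reflection {N : ℕ} (φ : Fin N → ℝ) : Matrix (Fin N) (Fin N) ℂ :=
  Matrix.diagonal fun r => Complex.exp (Complex.I * φ r)

/-- The global uplink channel `h = h_d + H_br Φ h_ru`. -/
def globalChannel {M N : ℕ} (hd : Fin M → ℂ) (Hbr : Matrix (Fin M) (Fin N) ℂ)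
    (hru : Fin N → ℂ) (φ : Fin N → ℝ) : Fin M → ℂ :=
  hd + (Hbr * reflection φ) *ᵥ hru

/-- The uplink SNR `hᴴ h τ`. -/
def snr {M N : ℕ} (τ : ℝ) (hd : Fin M → ℂ) (Hbr : Matrix (Fin M) (Fin N) ℂ)
    (hru : Fin N → ℂ) (φ : Fin N → ℝ) : ℝ :=
  (star (globalChannel hd Hbr hru φ) ⬝ᵥ globalChannel hd Hbr hru φ).re * τ

/-- The phases with `Φ = (z / |z|) diag(exp(j ∠a_r)) diag(exp(-j ∠h_ru))`, where `z = a_bᴴ h_d`.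
Since `Complex.arg 0 = 0`, the factor `z / |z|` is read as `1` when `z = 0`. -/
def optimalPhases {M N : ℕ} (ab : Fin M → ℂ) (ar : Fin N → ℂ) (hd : Fin M → ℂ)
    (hru : Fin N → ℂ) : Fin N → ℝ :=
  fun r => Complex.arg (star ab ⬝ᵥ hd) + Complex.arg (ar r) - Complex.arg (hru r)

/-- The function `x ↦ (π/4) (1 - x)² ₂F₁(3/2, 3/2; 1; x)`, meaningful for `0 ≤ x < 1`. -/
def pairFormula (x : ℝ) : ℝ :=
  Real.pi / 4 * (1 - x) ^ 2 * ordinaryHypergeometric (3 / 2 : ℝ) (3 / 2 : ℝ) (1 : ℝ) x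

/-- `pairFormula` with the value `1` at `x = 1`, where the hypergeometric series diverges. -/
def pairTerm (x : ℝ) : ℝ := if x < 1 then pairFormula x else 1

/-- The sum `F` over ordered pairs `i ≠ j`, with `ρ_ij` the entries of `R`. -/
def sumF {N : ℕ} (R : Matrix (Fin N) (Fin N) ℂ) : ℝ :=
  ∑ i : Fin N, ∑ j : Fin N, if i ≠ j then pairTerm (‖R i j‖ ^ 2) else 0

/-- `A = ‖R_d^{1/2} a_b‖₂`. -/
def normA {M : ℕ} (Rd : Matrix (Fin M) (Fin M) ℂ) (ab : Fin M → ℂ) : ℝ :=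
  ‖WithLp.toLp 2 (CFC.sqrt Rd *ᵥ ab)‖

end RIS

end

noncomputable section

namespace RIS

/-! Since `H_br` has rank one, `h = h_d + c a_b` with a scalar `c`, so `‖h‖² = ‖h_d‖² + 2 Re(c̄ a_bᴴ
h_d) + |c|² M`. The triangle inequality gives `|c| ≤ √β_br ∑ |h_ru,n|`, and the stated phases reach
this bound while aligning `c` with `a_bᴴ h_d`, so both terms are maximal at once
(`snr_le_coherentSnr`, `snr_optimalPhases`).

In the mean, the first term is a variance. The second factors by independence into means of moduli,
each `√π/2` times a standard deviation. The third needs `E|h_i||h_j|` for correlated Gaussians. The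
law of `T u` depends only on `T Tᴴ` (`map_mulVec_eq_of_mul_conjTranspose_eq`), so a normalised pair
may be replaced by `(u, c u + s w)` with `u, w` independent and `|c|² + s² = 1`. Substituting `y = c
u + s w` leaves two equal radial Gaussian weights coupled by `exp(Re(·))`. Angular averaging keeps
only even powers, and the radial moments `Γ(k + 3/2)` assemble into the hypergeometric series
(`lintegral_norm_mul_norm_series`). Full correlation is `s = 0`, where the mean is `E|u|² = 1`;
dominated convergence gives the limit. -/

/-! ### Density and radial moments of `CN(0, 1)`. -/

open Complex in
lemma stdComplexNormal_eq_map_measurableEquiv :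
    stdComplexNormal = ((gaussianReal 0 (1 / 2)).prod (gaussianReal 0 (1 / 2))).map
      measurableEquivRealProd.symm := rfl

instance : IsProbabilityMeasure stdComplexNormal := by
  rw [stdComplexNormal_eq_map_measurableEquiv]
  exact Measure.isProbabilityMeasure_map (MeasurableEquiv.measurable _).aemeasurable

instance (n : ℕ) : IsProbabilityMeasure (stdComplexNormalVec n) := by
  unfold stdComplexNormalVec; infer_instance

/-- The density of `CN(0, 1)` with respect to Lebesgue measure on `ℂ`. -/
def normalDensity (z : ℂ) : ENNReal := ENNReal.ofReal (Real.exp (-‖z‖ ^ 2) / Real.pi)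

@[fun_prop]
lemma measurable_normalDensity : Measurable normalDensity := by
  unfold normalDensity; fun_prop

lemma gaussianPDF_mul_gaussianPDF (z : ℂ) :
    gaussianPDF 0 (1 / 2) z.re * gaussianPDF 0 (1 / 2) z.im = normalDensity z := by
  rw [gaussianPDF, gaussianPDF, normalDensity, ← ENNReal.ofReal_mul (gaussianPDFReal_nonneg _ _ _)]
  congr 1
  have hpi : √Real.pi * √Real.pi = Real.pi := Real.mul_self_sqrt Real.pi_pos.le
  simp only [gaussianPDFReal, NNReal.coe_div, NNReal.coe_one, NNReal.coe_ofNat, sub_zero]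
  rw [← Complex.normSq_eq_norm_sq, Complex.normSq_apply,
    show (2 : ℝ) * Real.pi * (1 / 2) = Real.pi by ring, mul_mul_mul_comm, ← mul_inv, hpi,
    ← Real.exp_add, div_eq_inv_mul (Real.exp _) Real.pi]
  refine congrArg (fun x => Real.pi⁻¹ * Real.exp x) ?_
  ring

lemma stdComplexNormal_eq_withDensity :
    stdComplexNormal = (volume : Measure ℂ).withDensity normalDensity := by
  have hv : (1 / 2 : NNReal) ≠ 0 := by norm_num
  rw [stdComplexNormal_eq_map_measurableEquiv, gaussianReal_of_var_ne_zero _ hv,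
    prod_withDensity (measurable_gaussianPDF _ _) (measurable_gaussianPDF _ _)]
  ext s hs
  have hpre : MeasurableSet (Complex.measurableEquivRealProd.symm ⁻¹' s) :=
    Complex.measurableEquivRealProd.symm.measurable hs
  rw [Measure.map_apply (MeasurableEquiv.measurable _) hs, withDensity_apply _ hpre,
    withDensity_apply _ hs, ← Measure.volume_eq_prod,
    ← Complex.volume_preserving_equiv_real_prod.symm.setLIntegral_comp_preimage hs
      measurable_normalDensity]
  refine lintegral_congr fun p => ?_
  rw [← gaussianPDF_mul_gaussianPDF]
  rfl

lemma lintegral_stdComplexNormal {f : ℂ → ENNReal} (hf : Measurable f) :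
    ∫⁻ z, f z ∂stdComplexNormal = ∫⁻ z, normalDensity z * f z := by
  rw [stdComplexNormal_eq_withDensity,
    lintegral_withDensity_eq_lintegral_mul _ measurable_normalDensity hf]
  rfl

lemma lintegral_norm_pow_mul_exp (k : ℕ) {b : ℝ} (hb : 0 < b) :
    ∫⁻ z : ℂ, ENNReal.ofReal (‖z‖ ^ k * Real.exp (-b * ‖z‖ ^ 2)) =
      ENNReal.ofReal (Real.pi * b ^ (-((k : ℝ) + 2) / 2) * Real.Gamma (((k : ℝ) + 2) / 2)) := by
  have h := Complex.integral_rpow_mul_exp_neg_mul_rpow (p := 2) (q := k) (b := b) (by norm_num)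
    (by have := Nat.cast_nonneg (α := ℝ) k; linarith) hb
  simp only [Real.rpow_natCast, Real.rpow_ofNat] at h
  rw [show 2 * Real.pi / 2 = Real.pi by ring] at h
  have hpos : 0 < Real.pi * b ^ (-((k : ℝ) + 2) / 2) * Real.Gamma (((k : ℝ) + 2) / 2) := by
    have := Real.Gamma_pos_of_pos (s := ((k : ℝ) + 2) / 2) (by positivity)
    have := Real.pi_pos
    positivity
  rw [← h, ofReal_integral_eq_lintegral_ofReal]
  -- A non-integrable function has Bochner integral `0`, but the closed form is positive.
  · by_contra hi
    rw [integral_undef hi] at h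
    exact hpos.ne h
  · exact ae_of_all _ fun z => by positivity

lemma lintegral_norm_pow_stdComplexNormal (k : ℕ) :
    ∫⁻ z, ENNReal.ofReal (‖z‖ ^ k) ∂stdComplexNormal =
      ENNReal.ofReal (Real.Gamma (((k : ℝ) + 2) / 2)) := by
  rw [lintegral_stdComplexNormal (by fun_prop)]
  have h : ∀ z : ℂ, normalDensity z * ENNReal.ofReal (‖z‖ ^ k) =
      ENNReal.ofReal (Real.pi⁻¹) * ENNReal.ofReal (‖z‖ ^ k * Real.exp (-1 * ‖z‖ ^ 2)) := by
    intro z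
    have := Real.pi_pos
    rw [normalDensity, ← ENNReal.ofReal_mul (by positivity), ← ENNReal.ofReal_mul (by positivity)]
    congr 1
    rw [neg_one_mul]
    ring
  simp_rw [h]
  have := Real.pi_pos
  rw [lintegral_const_mul _ (by fun_prop), lintegral_norm_pow_mul_exp k one_pos,
    ← ENNReal.ofReal_mul (by positivity), Real.one_rpow]
  congr 1
  field_simp

lemma integral_norm_pow_stdComplexNormal (k : ℕ) :
    ∫ z, ‖z‖ ^ k ∂stdComplexNormal = Real.Gamma (((k : ℝ) + 2) / 2) := by
  rw [integral_eq_lintegral_of_nonneg_ae (ae_of_all _ fun z => by positivity)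
    (by fun_prop), lintegral_norm_pow_stdComplexNormal,
    ENNReal.toReal_ofReal (Real.Gamma_pos_of_pos (by positivity)).le]

lemma integral_norm_stdComplexNormal : ∫ z, ‖z‖ ∂stdComplexNormal = √Real.pi / 2 := by
  have h := integral_norm_pow_stdComplexNormal 1
  simp only [pow_one] at h
  rw [h, show (((1 : ℕ) : ℝ) + 2) / 2 = 1 / 2 + 1 by norm_num,
    Real.Gamma_add_one (by norm_num), Real.Gamma_one_half_eq]
  ring

lemma integral_norm_sq_stdComplexNormal : ∫ z, ‖z‖ ^ 2 ∂stdComplexNormal = 1 := by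
  rw [integral_norm_pow_stdComplexNormal 2]
  norm_num [Real.Gamma_two]

lemma memLp_two_id_stdComplexNormal : MemLp (fun z : ℂ => z) 2 stdComplexNormal := by
  rw [memLp_two_iff_integrable_sq_norm (by fun_prop)]
  refine Integrable.of_integral_ne_zero ?_
  rw [integral_norm_sq_stdComplexNormal]
  exact one_ne_zero

/-! ### Characteristic functions: the covariance determines the law. -/

lemma charFunDual_gaussianReal (L : StrongDual ℝ ℝ) :
    charFunDual (gaussianReal 0 (1 / 2)) L = Complex.exp (-((L 1 ^ 2 / 4 : ℝ) : ℂ)) := by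
  have h := charFun_gaussianReal (μ := 0) (v := 1 / 2) (L 1)
  rw [charFun_apply_real] at h
  rw [charFunDual_apply]
  have hL : ∀ x : ℝ, ((L x : ℝ) : ℂ) = (L 1 : ℂ) * x := fun x => by
    rw [← Complex.ofReal_mul, mul_comm, ← smul_eq_mul, ← map_smul, smul_eq_mul, mul_one]
  rw [integral_congr_ae (ae_of_all _ fun x => by rw [hL x]), h]
  congr 1
  push_cast
  ring

lemma charFunDual_stdComplexNormal (L : StrongDual ℝ ℂ) :
    charFunDual stdComplexNormal L =
      Complex.exp (-(((L 1 ^ 2 + L Complex.I ^ 2) / 4 : ℝ) : ℂ)) := by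
  have hmap : stdComplexNormal = ((gaussianReal 0 (1 / 2)).prod (gaussianReal 0 (1 / 2))).map
      (Complex.equivRealProdCLM.symm.toContinuousLinearMap) := rfl
  rw [hmap, charFunDual_map, charFunDual_prod, charFunDual_gaussianReal, charFunDual_gaussianReal,
    ← Complex.exp_add]
  have h1 : (Complex.equivRealProdCLM.symm ((1 : ℝ), (0 : ℝ))) = (1 : ℂ) := by
    apply Complex.ext <;> rfl
  have h2 : (Complex.equivRealProdCLM.symm ((0 : ℝ), (1 : ℝ))) = Complex.I := by
    apply Complex.ext <;> rfl
  simp only [ContinuousLinearMap.comp_apply, ContinuousLinearMap.inl_apply,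
    ContinuousLinearMap.inr_apply, ContinuousLinearEquiv.coe_coe, h1, h2]
  congr 1
  push_cast
  ring

/-- The continuous real-linear map `u ↦ T u`. -/
def mulVecCLM {m n : ℕ} (T : Matrix (Fin m) (Fin n) ℂ) : (Fin n → ℂ) →L[ℝ] (Fin m → ℂ) :=
  LinearMap.toContinuousLinearMap (T.mulVecLin.restrictScalars ℝ)

@[simp]
lemma mulVecCLM_apply {m n : ℕ} (T : Matrix (Fin m) (Fin n) ℂ) (u : Fin n → ℂ) :
    mulVecCLM T u = T *ᵥ u := rfl

/-- Puts every real functional in the form `Re (t ⬝ᵥ v)`, so that characteristic functions become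
matrix expressions. -/
lemma strongDual_pi_apply {m : ℕ} (L : StrongDual ℝ (Fin m → ℂ)) (v : Fin m → ℂ) :
    L v = ((fun j => (L (Pi.single j 1) : ℂ) - L (Pi.single j Complex.I) * Complex.I) ⬝ᵥ v).re := by
  rw [dotProduct, Complex.re_sum, ← L.sum_comp_single]
  refine Finset.sum_congr rfl fun j _ => ?_
  have hv : ContinuousLinearMap.single ℝ (fun _ : Fin m => ℂ) j (v j) =
      (v j).re • (Pi.single j (1 : ℂ) : Fin m → ℂ) +
        (v j).im • (Pi.single j Complex.I : Fin m → ℂ) := by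
    ext i
    by_cases h : i = j
    · subst h; simp [Complex.re_add_im]
    · simp [h]
  simp [hv, mul_comm]

/-- Pulled back along `T`, the functional has coefficients `t ᵥ* T`; each coordinate contributes the
squared modulus of its coefficient, and these sum to a quadratic form in `T Tᴴ` alone. -/
lemma charFunDual_map_mulVec {m n : ℕ} (T : Matrix (Fin m) (Fin n) ℂ)
    (L : StrongDual ℝ (Fin m → ℂ)) {t : Fin m → ℂ} (ht : ∀ v, L v = (t ⬝ᵥ v).re) :
    charFunDual ((stdComplexNormalVec n).map (mulVecCLM T)) L =
      Complex.exp (-((t ᵥ* (T * Tᴴ)) ⬝ᵥ star t) / 4) := by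
  rw [charFunDual_map, stdComplexNormalVec, charFunDual_pi]
  simp_rw [charFunDual_stdComplexNormal]
  rw [← Complex.exp_sum]
  congr 1
  rw [← Matrix.vecMul_vecMul, ← Matrix.dotProduct_mulVec, Matrix.mulVec_conjTranspose,
    star_star, dotProduct, neg_div, Finset.sum_div, ← Finset.sum_neg_distrib]
  refine Finset.sum_congr rfl fun k _ => ?_
  congr 1
  have key : ∀ z : ℂ, (L ∘SL mulVecCLM T ∘SL ContinuousLinearMap.single ℝ (fun _ => ℂ) k) z =
      ((t ᵥ* T) k * z).re := by
    intro z
    simp only [ContinuousLinearMap.comp_apply, mulVecCLM_apply, ht, Matrix.dotProduct_mulVec]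
    congr 1
    exact dotProduct_single _ _ _
  simp only [ContinuousLinearMap.comp_apply] at key ⊢
  rw [key, key]
  simp only [mul_one, Complex.mul_I_re, Pi.star_apply, RCLike.star_def, Complex.mul_conj,
    Complex.normSq_apply]
  push_cast
  ring

/-- The law of `T u` with `u ∼ CN(0, I)` depends only on its covariance matrix `T Tᴴ`. -/
lemma map_mulVec_eq_of_mul_conjTranspose_eq {m n p : ℕ} {T : Matrix (Fin m) (Fin n) ℂ}
    {T' : Matrix (Fin m) (Fin p) ℂ} (h : T * Tᴴ = T' * T'ᴴ) :
    (stdComplexNormalVec n).map (fun u => T *ᵥ u) =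
      (stdComplexNormalVec p).map (fun u => T' *ᵥ u) := by
  change (stdComplexNormalVec n).map (mulVecCLM T) = (stdComplexNormalVec p).map (mulVecCLM T')
  have := Measure.isProbabilityMeasure_map (μ := stdComplexNormalVec n)
    (mulVecCLM T).continuous.aemeasurable
  have := Measure.isProbabilityMeasure_map (μ := stdComplexNormalVec p)
    (mulVecCLM T').continuous.aemeasurable
  refine Measure.ext_of_charFunDual (funext fun L => ?_)
  rw [charFunDual_map_mulVec T L (strongDual_pi_apply L),
    charFunDual_map_mulVec T' L (strongDual_pi_apply L), h]

lemma integral_comp_mulVec_eq {m n p : ℕ} {T : Matrix (Fin m) (Fin n) ℂ}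
    {T' : Matrix (Fin m) (Fin p) ℂ} (h : T * Tᴴ = T' * T'ᴴ) {f : (Fin m → ℂ) → ℝ}
    (hf : Measurable f) :
    ∫ u, f (T *ᵥ u) ∂stdComplexNormalVec n = ∫ u, f (T' *ᵥ u) ∂stdComplexNormalVec p := by
  have hT : ∀ {q : ℕ} (S : Matrix (Fin m) (Fin q) ℂ), Measurable fun u => S *ᵥ u :=
    fun S => (mulVecCLM S).continuous.measurable
  rw [← integral_map (hT T).aemeasurable hf.aestronglyMeasurable,
    map_mulVec_eq_of_mul_conjTranspose_eq h,
    integral_map (hT T').aemeasurable hf.aestronglyMeasurable]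

/-! ### Angular averaging against radial weights. -/

lemma integral_cos_pow_even_full (k : ℕ) :
    ∫ θ in (-Real.pi)..Real.pi, Real.cos θ ^ (2 * k) =
      2 * Real.pi * (((2 * k).factorial : ℝ) / (4 ^ k * (k.factorial : ℝ) ^ 2)) := by
  induction k with
  | zero => simp; ring
  | succ k ih =>
    rw [show 2 * (k + 1) = 2 * k + 2 by ring, integral_cos_pow, ih]
    simp only [Nat.factorial_succ, Real.sin_neg, Real.sin_pi]
    push_cast
    have : (k.factorial : ℝ) ≠ 0 := by positivity
    field_simp
    ring

lemma lintegral_cos_pow_even (k : ℕ) :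
    ∫⁻ θ in Set.Ioo (-Real.pi) Real.pi, ENNReal.ofReal (Real.cos θ ^ (2 * k)) =
      ENNReal.ofReal (2 * Real.pi * (((2 * k).factorial : ℝ) / (4 ^ k * (k.factorial : ℝ) ^ 2))) := by
  have hle : -Real.pi ≤ Real.pi := by linarith [Real.pi_pos]
  rw [← integral_cos_pow_even_full, intervalIntegral.integral_of_le hle,
    ofReal_integral_eq_lintegral_ofReal, restrict_Ioo_eq_restrict_Ioc]
  · have hc : Continuous fun θ : ℝ => Real.cos θ ^ (2 * k) := by fun_prop
    exact (hc.integrableOn_Icc).mono_set Set.Ioc_subset_Icc_self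
  · exact ae_of_all _ fun θ => by
      change 0 ≤ Real.cos θ ^ (2 * k)
      rw [pow_mul]; positivity

lemma lintegral_polar_separate {g : ℝ → ENNReal} (hg : Measurable g) {a : ℝ → ENNReal}
    (ha : Measurable a) {f : ℂ → ENNReal}
    (hf : ∀ p ∈ Complex.polarCoord.target, f (Complex.polarCoord.symm p) = g p.1 * a p.2) :
    ∫⁻ z, f z = (∫⁻ r in Set.Ioi 0, ENNReal.ofReal r * g r) *
      ∫⁻ θ in Set.Ioo (-Real.pi) Real.pi, a θ := by
  rw [← Complex.lintegral_comp_polarCoord_symm, ← lintegral_prod_mul (by fun_prop) (by fun_prop),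
    Measure.prod_restrict, ← Measure.volume_eq_prod]
  refine setLIntegral_congr_fun (measurableSet_Ioi.prod measurableSet_Ioo) fun p hp => ?_
  rw [hf p hp, smul_eq_mul, mul_assoc]

/-- Angular averaging of even powers of the real part against a radial weight. -/
lemma lintegral_radial_mul_re_pow {g : ℝ → ENNReal} (hg : Measurable g) (k : ℕ) :
    ∫⁻ z : ℂ, g ‖z‖ * ENNReal.ofReal (z.re ^ (2 * k)) =
      ENNReal.ofReal (((2 * k).factorial : ℝ) / (4 ^ k * (k.factorial : ℝ) ^ 2)) *
        ∫⁻ z : ℂ, g ‖z‖ * ENNReal.ofReal (‖z‖ ^ (2 * k)) := by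
  have hpos : ∀ p ∈ Complex.polarCoord.target, 0 < p.1 := fun p hp => hp.1
  rw [lintegral_polar_separate (g := fun r => g r * ENNReal.ofReal (r ^ (2 * k)))
      (a := fun θ => ENNReal.ofReal (Real.cos θ ^ (2 * k))) (by fun_prop) (by fun_prop),
    lintegral_polar_separate (g := fun r => g r * ENNReal.ofReal (r ^ (2 * k)))
      (a := fun _ => 1) (by fun_prop) (by fun_prop), lintegral_cos_pow_even]
  · have := Real.pi_pos
    rw [setLIntegral_one, Real.volume_Ioo, sub_neg_eq_add, ← two_mul,
      ENNReal.ofReal_mul (by positivity)]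
    ring
  · intro p hp
    rw [Complex.norm_polarCoord_symm, abs_of_pos (hpos p hp), mul_one]
  · intro p hp
    have h0 : 0 ≤ p.1 ^ (2 * k) := by have := hpos p hp; positivity
    have hre : (Complex.polarCoord.symm p).re = p.1 * Real.cos p.2 := by
      rw [Complex.polarCoord_symm_apply]
      simp [Complex.cos_ofReal_re]
    rw [Complex.norm_polarCoord_symm, abs_of_pos (hpos p hp), hre, mul_pow,
      ENNReal.ofReal_mul h0, mul_assoc]

lemma exists_rotation_mul_eq (w : ℂ) : ∃ a : Circle, ∀ z : ℂ, w * (a * z) = ‖w‖ * z := by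
  refine ⟨Circle.exp (-w.arg), fun z => ?_⟩
  nth_rewrite 1 [← Complex.norm_mul_exp_arg_mul_I w]
  rw [Circle.coe_exp, mul_assoc, ← mul_assoc (Complex.exp _), ← Complex.exp_add]
  simp

/-- Rotation invariance of Lebesgue measure replaces `w` by `‖w‖`. -/
lemma lintegral_radial_mul_re_mul_pow {g : ℝ → ENNReal} (hg : Measurable g) (w : ℂ) (k : ℕ) :
    ∫⁻ z : ℂ, g ‖z‖ * ENNReal.ofReal ((w * z).re ^ (2 * k)) =
      ENNReal.ofReal (‖w‖ ^ (2 * k) * (((2 * k).factorial : ℝ) / (4 ^ k * (k.factorial : ℝ) ^ 2))) *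
        ∫⁻ z : ℂ, g ‖z‖ * ENNReal.ofReal (‖z‖ ^ (2 * k)) := by
  obtain ⟨a, ha⟩ := exists_rotation_mul_eq w
  rw [← (rotation a).measurePreserving.lintegral_comp (by fun_prop),
    ENNReal.ofReal_mul (by positivity), mul_assoc, ← lintegral_radial_mul_re_pow hg,
    ← lintegral_const_mul _ (by fun_prop)]
  refine lintegral_congr fun z => ?_
  rw [LinearIsometryEquiv.norm_map, rotation_apply, ha, Complex.re_ofReal_mul, mul_pow,
    ENNReal.ofReal_mul (by positivity), mul_left_comm]

/-- Expansion of `∫ g(|z|) exp(Re (w z))` into radial moments. -/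
lemma lintegral_radial_mul_exp_re {g : ℝ → ENNReal} (hg : Measurable g) (w : ℂ) :
    ∫⁻ z : ℂ, g ‖z‖ * ENNReal.ofReal (Real.exp (w * z).re) =
      ∑' k : ℕ, ENNReal.ofReal (‖w‖ ^ (2 * k) / (4 ^ k * (k.factorial : ℝ) ^ 2)) *
        ∫⁻ z : ℂ, g ‖z‖ * ENNReal.ofReal (‖z‖ ^ (2 * k)) := by
  -- Symmetrising under `z ↦ -z` turns `exp` into `cosh`, whose series has nonnegative terms; sum
  -- and integral then commute without any integrability check.
  have hcosh : ∫⁻ z : ℂ, g ‖z‖ * ENNReal.ofReal (Real.exp (w * z).re) =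
      ∫⁻ z : ℂ, g ‖z‖ * ENNReal.ofReal (Real.cosh (w * z).re) := by
    have hneg : ∫⁻ z : ℂ, g ‖z‖ * ENNReal.ofReal (Real.exp (w * z).re) =
        ∫⁻ z : ℂ, g ‖z‖ * ENNReal.ofReal (Real.exp (-(w * z).re)) := by
      rw [← (Measure.measurePreserving_neg (volume : Measure ℂ)).lintegral_comp (by fun_prop)]
      simp
    rw [← ENNReal.mul_right_inj two_ne_zero ENNReal.ofNat_ne_top]
    nth_rewrite 1 [two_mul]
    nth_rewrite 2 [hneg]
    rw [← lintegral_add_left (by fun_prop), ← lintegral_const_mul _ (by fun_prop)]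
    refine lintegral_congr fun z => ?_
    rw [← mul_add, ← ENNReal.ofReal_add (by positivity) (by positivity), mul_left_comm,
      ← ENNReal.ofReal_ofNat, ← ENNReal.ofReal_mul (by norm_num), Real.cosh_eq]
    congr 2
    ring
  have hk : ∀ (k : ℕ) (x : ℝ), 0 ≤ x ^ (2 * k) := fun k x => by rw [pow_mul]; positivity
  rw [hcosh]
  have hterm : ∀ z : ℂ, g ‖z‖ * ENNReal.ofReal (Real.cosh (w * z).re) =
      ∑' k : ℕ, ENNReal.ofReal (((2 * k).factorial : ℝ)⁻¹) *
        (g ‖z‖ * ENNReal.ofReal ((w * z).re ^ (2 * k))) := by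
    intro z
    rw [Real.cosh_eq_tsum, ENNReal.ofReal_tsum_of_nonneg
      (fun k => div_nonneg (hk k _) (by positivity)) (Real.hasSum_cosh _).summable,
      ← ENNReal.tsum_mul_left]
    refine tsum_congr fun k => ?_
    rw [mul_left_comm, ← ENNReal.ofReal_mul (by positivity), div_eq_inv_mul]
  simp_rw [hterm]
  rw [lintegral_tsum (fun k => by fun_prop)]
  refine tsum_congr fun k => ?_
  rw [lintegral_const_mul _ (by fun_prop), lintegral_radial_mul_re_mul_pow hg, ← mul_assoc,
    ← ENNReal.ofReal_mul (by positivity)]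
  congr 2
  have : ((2 * k).factorial : ℝ) ≠ 0 := by positivity
  field_simp

/-! ### The mean product of two correlated moduli as a series. -/

lemma lintegral_comp_add_smul {f : ℂ → ENNReal} (hf : Measurable f) (b : ℂ) {s : ℝ} (hs : 0 < s) :
    ∫⁻ w, f (b + s • w) = ENNReal.ofReal ((s ^ 2)⁻¹) * ∫⁻ y, f y := by
  have h := lintegral_map (μ := volume) (f := fun y => f (b + y)) (g := fun w : ℂ => s • w)
    (by fun_prop) (by fun_prop)
  rw [← h, Measure.map_addHaar_smul _ hs.ne', lintegral_smul_measure, Complex.finrank_real_complex,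
    abs_of_pos (by positivity), lintegral_add_left_eq_self, smul_eq_mul]

/-- Expanding the square, `‖c‖² = 1 - s²` makes the coefficient of `‖u‖²` equal to `-1/s²`, the same
as for `‖y‖²`; only the cross term couples `u` and `y`. -/
lemma exp_neg_norm_sq_mul_shift {c u y : ℂ} {s : ℝ} (hs : 0 < s) (hcs : ‖c‖ ^ 2 + s ^ 2 = 1) :
    Real.exp (-‖u‖ ^ 2) * Real.exp (-(‖y - c * u‖ / s) ^ 2) =
      Real.exp (-(s ^ 2)⁻¹ * ‖u‖ ^ 2) * Real.exp (-(s ^ 2)⁻¹ * ‖y‖ ^ 2) *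
        Real.exp ((2 * (s ^ 2)⁻¹ : ℝ) * star (c * u) * y).re := by
  rw [← Real.exp_add, ← Real.exp_add, ← Real.exp_add]
  congr 1
  have h1 : ‖y - c * u‖ ^ 2 = ‖y‖ ^ 2 - 2 * (star (c * u) * y).re + ‖c‖ ^ 2 * ‖u‖ ^ 2 := by
    rw [← mul_pow, ← norm_mul]
    simp only [← Complex.normSq_eq_norm_sq, Complex.normSq_apply, Complex.mul_re, Complex.sub_re,
      Complex.sub_im, RCLike.star_def, Complex.conj_re, Complex.conj_im]
    ring
  rw [mul_assoc (_ : ℂ) (star _), Complex.re_ofReal_mul, div_pow, h1]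
  have h2 : ‖c‖ ^ 2 = 1 - s ^ 2 := by linarith
  rw [h2]
  field_simp
  ring

lemma lintegral_norm_mul_exp_mul_pow (k : ℕ) {b : ℝ} (hb : 0 < b) :
    ∫⁻ z : ℂ, ENNReal.ofReal (‖z‖ * Real.exp (-b * ‖z‖ ^ 2)) * ENNReal.ofReal (‖z‖ ^ (2 * k)) =
      ENNReal.ofReal (Real.pi * b ^ (-((k : ℝ) + 3 / 2)) * Real.Gamma (k + 3 / 2)) := by
  have h := lintegral_norm_pow_mul_exp (2 * k + 1) hb
  rw [show (((2 * k + 1 : ℕ) : ℝ) + 2) / 2 = k + 3 / 2 by push_cast; ring, neg_div,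
    show (((2 * k + 1 : ℕ) : ℝ) + 2) / 2 = k + 3 / 2 by push_cast; ring] at h
  rw [← h]
  refine lintegral_congr fun z => ?_
  rw [← ENNReal.ofReal_mul (by positivity)]
  congr 1
  ring

lemma lintegral_norm_mul_norm_series {c : ℂ} {s : ℝ} (hs : 0 < s) (hcs : ‖c‖ ^ 2 + s ^ 2 = 1) :
    ∫⁻ u, ∫⁻ w, ENNReal.ofReal (‖u‖ * ‖c * u + s * w‖) ∂stdComplexNormal ∂stdComplexNormal =
      ∑' k : ℕ, ENNReal.ofReal
        (s ^ 4 * (‖c‖ ^ 2) ^ k * Real.Gamma (k + 3 / 2) ^ 2 / (k.factorial : ℝ) ^ 2) := by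
  have hpi := Real.pi_pos
  set b : ℝ := (s ^ 2)⁻¹ with hb
  have hbpos : 0 < b := by positivity
  set g : ℝ → ENNReal := fun r => ENNReal.ofReal (r * Real.exp (-b * r ^ 2)) with hg
  have hgm : Measurable g := by fun_prop
  have hinner : ∀ u : ℂ,
      normalDensity u * ∫⁻ w, ENNReal.ofReal (‖u‖ * ‖c * u + s * w‖) ∂stdComplexNormal =
        ENNReal.ofReal (b / Real.pi ^ 2) * g ‖u‖ *
          ∫⁻ y : ℂ, g ‖y‖ * ENNReal.ofReal (Real.exp ((2 * b : ℝ) * star (c * u) * y).re) := by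
    intro u
    -- The density of `w` as a function of `y = c u + s w`; the change of variables then costs
    -- `s⁻²`, the real dimension being two.
    have hshift : ∀ w : ℂ, normalDensity w * ENNReal.ofReal (‖u‖ * ‖c * u + s * w‖) =
        (fun y : ℂ => ENNReal.ofReal
          (Real.exp (-(‖y - c * u‖ / s) ^ 2) / Real.pi * (‖u‖ * ‖y‖))) (c * u + s • w) := by
      intro w
      simp only [normalDensity, add_sub_cancel_left, Complex.real_smul, norm_mul,
        Complex.norm_real, Real.norm_of_nonneg hs.le, mul_div_cancel_left₀ _ hs.ne']
      rw [← ENNReal.ofReal_mul (by positivity)]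
    rw [lintegral_stdComplexNormal (by fun_prop),
      (lintegral_congr hshift).trans (lintegral_comp_add_smul (f := fun y : ℂ => ENNReal.ofReal
        (Real.exp (-(‖y - c * u‖ / s) ^ 2) / Real.pi * (‖u‖ * ‖y‖))) (by fun_prop) _ hs),
      ← mul_assoc,
      ← lintegral_const_mul _ (by fun_prop), ← lintegral_const_mul _ (by fun_prop)]
    refine lintegral_congr fun y => ?_
    simp only [normalDensity, hg]
    repeat rw [← ENNReal.ofReal_mul (by positivity)]
    congr 1
    have h := exp_neg_norm_sq_mul_shift (u := u) (y := y) hs hcs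
    rw [← hb] at h ⊢
    linear_combination (b / Real.pi ^ 2 * ‖u‖ * ‖y‖) * h
  rw [lintegral_stdComplexNormal]
  swap
  · exact Measurable.lintegral_prod_right' (f := fun p : ℂ × ℂ =>
      ENNReal.ofReal (‖p.1‖ * ‖c * p.1 + s * p.2‖)) (by fun_prop)
  simp_rw [hinner, lintegral_radial_mul_exp_re hgm, ← ENNReal.tsum_mul_left]
  rw [lintegral_tsum (fun k => by fun_prop)]
  refine tsum_congr fun k => ?_
  have hm : ∫⁻ z : ℂ, g ‖z‖ * ENNReal.ofReal (‖z‖ ^ (2 * k)) =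
      ENNReal.ofReal (Real.pi * b ^ (-((k : ℝ) + 3 / 2)) * Real.Gamma (k + 3 / 2)) :=
    lintegral_norm_mul_exp_mul_pow k hbpos
  have hG : 0 < Real.Gamma ((k : ℝ) + 3 / 2) := Real.Gamma_pos_of_pos (by positivity)
  have hterm : ∀ u : ℂ, ENNReal.ofReal (b / Real.pi ^ 2) * g ‖u‖ *
      (ENNReal.ofReal (‖((2 * b : ℝ) : ℂ) * star (c * u)‖ ^ (2 * k) /
        (4 ^ k * (k.factorial : ℝ) ^ 2)) * ∫⁻ z : ℂ, g ‖z‖ * ENNReal.ofReal (‖z‖ ^ (2 * k))) =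
      ENNReal.ofReal (b / Real.pi ^ 2 * (b ^ (2 * k) * (‖c‖ ^ 2) ^ k / (k.factorial : ℝ) ^ 2) *
        (Real.pi * b ^ (-((k : ℝ) + 3 / 2)) * Real.Gamma (k + 3 / 2))) *
        (g ‖u‖ * ENNReal.ofReal (‖u‖ ^ (2 * k))) := by
    intro u
    have hw : ‖((2 * b : ℝ) : ℂ) * star (c * u)‖ ^ (2 * k) / (4 ^ k * (k.factorial : ℝ) ^ 2) =
        b ^ (2 * k) * (‖c‖ ^ 2) ^ k / (k.factorial : ℝ) ^ 2 * ‖u‖ ^ (2 * k) := by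
      rw [norm_mul, norm_star, norm_mul, Complex.norm_real, Real.norm_of_nonneg (by positivity),
        mul_pow, mul_pow, mul_pow, pow_mul 2 2 k, ← pow_mul ‖c‖]
      norm_num
      field_simp
    rw [hm, hw, ENNReal.ofReal_mul (p := b / Real.pi ^ 2 * _) (by positivity),
      ENNReal.ofReal_mul (p := b / Real.pi ^ 2) (by positivity),
      ENNReal.ofReal_mul (q := ‖u‖ ^ (2 * k)) (by positivity)]
    ring
  simp_rw [hterm]
  rw [lintegral_const_mul _ (by fun_prop), hm, ← ENNReal.ofReal_mul (by positivity)]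
  congr 1
  -- Powers of `b = s⁻²`: the prefactor gives `b ^ (2k + 1)` and the two radial moments give `b ^
  -- (-(2k + 3))`, leaving `b⁻² = s⁴`.
  have hrpow : b ^ (-((k : ℝ) + 3 / 2)) * b ^ (-((k : ℝ) + 3 / 2)) = (b ^ (2 * k) * b ^ 3)⁻¹ := by
    rw [← Real.rpow_add hbpos, ← pow_add, ← Real.rpow_natCast, ← Real.rpow_neg hbpos.le]
    congr 1
    push_cast
    ring
  have hs4 : s ^ 4 * b ^ 2 = 1 := by rw [hb]; field_simp
  calc _ = b / Real.pi ^ 2 * (b ^ (2 * k) * (‖c‖ ^ 2) ^ k / (k.factorial : ℝ) ^ 2) * Real.pi ^ 2 *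
        Real.Gamma (k + 3 / 2) ^ 2 *
          (b ^ (-((k : ℝ) + 3 / 2)) * b ^ (-((k : ℝ) + 3 / 2))) := by ring
    _ = (‖c‖ ^ 2) ^ k * Real.Gamma (k + 3 / 2) ^ 2 / (k.factorial : ℝ) ^ 2 * (b ^ 2)⁻¹ := by
      rw [hrpow]
      field_simp
    _ = _ := by
      rw [← eq_inv_of_mul_eq_one_left hs4]
      ring

/-! ### Hypergeometric form and the limit at full correlation. -/

lemma Gamma_nat_add_three_halves (k : ℕ) :
    Real.Gamma (k + 3 / 2) = √Real.pi / 2 * (ascPochhammer ℝ k).eval (3 / 2) := by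
  induction k with
  | zero =>
    rw [show ((0 : ℕ) : ℝ) + 3 / 2 = 1 / 2 + 1 by norm_num, Real.Gamma_add_one (by norm_num),
      Real.Gamma_one_half_eq]
    simp
    ring
  | succ k ih =>
    rw [show ((k + 1 : ℕ) : ℝ) + 3 / 2 = (k + 3 / 2) + 1 by push_cast; ring,
      Real.Gamma_add_one (by positivity), ih, ascPochhammer_succ_eval]
    ring

/-- The squared Gamma values supply `π/4` and both Pochhammer factors at `3/2`; `(1)_k = k!`
supplies the second factorial. The identity is termwise, so convergence plays no role. -/
lemma pairFormula_eq_tsum (x : ℝ) :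
    pairFormula x = ∑' k : ℕ, (1 - x) ^ 2 * x ^ k * Real.Gamma (k + 3 / 2) ^ 2 /
      (k.factorial : ℝ) ^ 2 := by
  rw [pairFormula, ordinaryHypergeometric_eq_tsum, ← tsum_mul_left]
  refine tsum_congr fun k => ?_
  rw [ascPochhammer_eval_one, Gamma_nat_add_three_halves, mul_pow, div_pow,
    Real.sq_sqrt Real.pi_pos.le, smul_eq_mul]
  have : (k.factorial : ℝ) ≠ 0 := by positivity
  field_simp
  ring

/-- The mean of the product of the moduli of two correlated complex Gaussians. -/
def pairMean (c : ℂ) (s : ℝ) : ℝ :=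
  ∫ p, ‖p.1‖ * ‖c * p.1 + s * p.2‖ ∂(stdComplexNormal.prod stdComplexNormal)

lemma pairMean_eq_pairFormula {c : ℂ} {s : ℝ} (hs : 0 < s) (hcs : ‖c‖ ^ 2 + s ^ 2 = 1) :
    pairMean c s = pairFormula (‖c‖ ^ 2) := by
  rw [pairMean, integral_eq_lintegral_of_nonneg_ae (ae_of_all _ fun p => by positivity)
    (by fun_prop), lintegral_prod _ (by fun_prop)]
  have h := lintegral_norm_mul_norm_series hs hcs
  rw [h, ENNReal.tsum_toReal_eq fun k => ENNReal.ofReal_ne_top, pairFormula_eq_tsum]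
  refine tsum_congr fun k => ?_
  have hG : 0 < Real.Gamma ((k : ℝ) + 3 / 2) := Real.Gamma_pos_of_pos (by positivity)
  -- Writing `1` as `‖c‖² + s²` turns `(1 - ‖c‖²)²` into `s⁴`.
  rw [ENNReal.toReal_ofReal (by positivity), ← hcs]
  ring

/-- Majorant of the integrand of `pairMean` when both coefficients have modulus at most one. -/
lemma integrable_norm_mul_norm_add :
    Integrable (fun p : ℂ × ℂ => ‖p.1‖ * (‖p.1‖ + ‖p.2‖))
      (stdComplexNormal.prod stdComplexNormal) := by
  have h1 : MemLp (fun p : ℂ × ℂ => ‖p.1‖) 2 (stdComplexNormal.prod stdComplexNormal) :=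
    (memLp_two_id_stdComplexNormal.norm).comp_measurePreserving measurePreserving_fst
  have h2 : MemLp (fun p : ℂ × ℂ => ‖p.2‖) 2 (stdComplexNormal.prod stdComplexNormal) :=
    (memLp_two_id_stdComplexNormal.norm).comp_measurePreserving measurePreserving_snd
  exact h1.integrable_mul (h1.add h2)

lemma pairMean_of_norm_eq_one {c : ℂ} (hc : ‖c‖ = 1) : pairMean c 0 = 1 := by
  have h : ∀ p : ℂ × ℂ, ‖p.1‖ * ‖c * p.1 + (0 : ℝ) * p.2‖ = ‖p.1‖ ^ 2 := fun p => by
    simp [hc, sq]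
  simp_rw [pairMean, h]
  rw [integral_fun_fst (fun z : ℂ => ‖z‖ ^ 2)]
  simp [integral_norm_sq_stdComplexNormal]

lemma pairMean_eq_pairTerm {c : ℂ} (hc : ‖c‖ ≤ 1) :
    pairMean c √(1 - ‖c‖ ^ 2) = pairTerm (‖c‖ ^ 2) := by
  have hc2 : ‖c‖ ^ 2 ≤ 1 := pow_le_one₀ (norm_nonneg _) hc
  rw [pairTerm]
  split_ifs with h
  · refine pairMean_eq_pairFormula (Real.sqrt_pos.2 (by linarith)) ?_
    rw [Real.sq_sqrt (by linarith)]
    ring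
  · have h1 : ‖c‖ ^ 2 = 1 := le_antisymm hc2 (not_lt.1 h)
    rw [h1, sub_self, Real.sqrt_zero, pairMean_of_norm_eq_one]
    exact (pow_eq_one_iff_of_nonneg (norm_nonneg _) two_ne_zero).1 h1

/-- The limit is taken on the probabilistic side, where the integrand is continuous up to `s = 0`,
rather than in the hypergeometric series. -/
lemma tendsto_pairFormula : Tendsto pairFormula (𝓝[<] 1) (𝓝 1) := by
  have hmean : Tendsto (fun x : ℝ => pairMean (√x : ℝ) √(1 - x)) (𝓝[<] 1) (𝓝 1) := by
    have h1 : pairMean (√1 : ℝ) √(1 - 1) = 1 := by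
      rw [sub_self, Real.sqrt_zero]
      exact pairMean_of_norm_eq_one (by simp)
    suffices Tendsto (fun x : ℝ => pairMean (√x : ℝ) √(1 - x)) (𝓝[<] 1)
        (𝓝 (pairMean (√1 : ℝ) √(1 - 1))) by rwa [h1] at this
    refine tendsto_integral_filter_of_dominated_convergence _
      (Eventually.of_forall fun x => by fun_prop) ?_ integrable_norm_mul_norm_add
      (ae_of_all _ fun p => ?_)
    · filter_upwards [Ioo_mem_nhdsLT (zero_lt_one' ℝ)] with x hx
      refine ae_of_all _ fun p => ?_
      rw [norm_mul, norm_norm, norm_norm]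
      refine mul_le_mul_of_nonneg_left ((norm_add_le _ _).trans ?_) (norm_nonneg _)
      rw [norm_mul, norm_mul, Complex.norm_real, Complex.norm_real,
        Real.norm_of_nonneg (Real.sqrt_nonneg _), Real.norm_of_nonneg (Real.sqrt_nonneg _)]
      refine add_le_add (mul_le_of_le_one_left (norm_nonneg _) (Real.sqrt_le_one.2 hx.2.le))
        (mul_le_of_le_one_left (norm_nonneg _) (Real.sqrt_le_one.2 (by linarith [hx.1])))
    · have hc : Continuous fun x : ℝ => ‖p.1‖ * ‖((√x : ℝ) : ℂ) * p.1 + (√(1 - x) : ℝ) * p.2‖ := by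
        fun_prop
      exact (hc.tendsto 1).mono_left nhdsWithin_le_nhds
  refine hmean.congr' ?_
  filter_upwards [Ioo_mem_nhdsLT (zero_lt_one' ℝ)] with x hx
  have hn : ‖((√x : ℝ) : ℂ)‖ ^ 2 = x := by
    rw [Complex.norm_real, Real.norm_of_nonneg (Real.sqrt_nonneg _), Real.sq_sqrt hx.1.le]
  rw [pairMean_eq_pairFormula (Real.sqrt_pos.2 (by linarith [hx.2])), hn]
  rw [hn, Real.sq_sqrt (by linarith [hx.2])]
  ring

/-! ### Moments of linear forms of a Gaussian vector. -/

@[fun_prop]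
lemma measurable_dotProduct_right {n : ℕ} (a : Fin n → ℂ) :
    Measurable fun u : Fin n → ℂ => a ⬝ᵥ u := by
  simp only [dotProduct]; fun_prop

lemma memLp_two_dotProduct {n : ℕ} (a : Fin n → ℂ) :
    MemLp (fun u : Fin n → ℂ => a ⬝ᵥ u) 2 (stdComplexNormalVec n) := by
  simp only [dotProduct]
  refine memLp_finsetSum _ fun k _ => MemLp.const_mul ?_ _
  exact memLp_two_id_stdComplexNormal.comp_measurePreserving
    (measurePreserving_eval (fun _ : Fin n => stdComplexNormal) k)

/-- Seen as a one-row matrix, `a` has the same covariance as the scalar `A`, so `a ⬝ᵥ u` is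
distributed as `A z`. -/
lemma integral_norm_dotProduct_comp {n : ℕ} {a : Fin n → ℂ} {A : ℝ} (hA : 0 ≤ A)
    (ha : a ⬝ᵥ star a = (A : ℂ) ^ 2) {f : ℝ → ℝ} (hf : Measurable f) :
    ∫ u, f ‖a ⬝ᵥ u‖ ∂stdComplexNormalVec n = ∫ z, f (A * ‖z‖) ∂stdComplexNormal := by
  have hcov : Matrix.of (fun _ : Fin 1 => a) * (Matrix.of fun _ : Fin 1 => a)ᴴ =
      !![(A : ℂ)] * (!![(A : ℂ)])ᴴ := by
    ext i j
    fin_cases i; fin_cases j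
    change a ⬝ᵥ star a = _
    rw [ha]
    simp [Matrix.mul_apply, sq]
  have h := integral_comp_mulVec_eq hcov (f := fun v => f ‖v 0‖) (by fun_prop)
  refine h.trans ?_
  have he := measurePreserving_eval (fun _ : Fin 1 => stdComplexNormal) 0
  rw [← he.map_eq, integral_map he.aemeasurable
    (Measurable.aestronglyMeasurable (by fun_prop))]
  refine integral_congr_ae (ae_of_all _ fun v => ?_)
  simp [Matrix.mulVec, dotProduct, abs_of_nonneg hA]

lemma integral_norm_dotProduct {n : ℕ} {a : Fin n → ℂ} {A : ℝ} (hA : 0 ≤ A)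
    (ha : a ⬝ᵥ star a = (A : ℂ) ^ 2) :
    ∫ u, ‖a ⬝ᵥ u‖ ∂stdComplexNormalVec n = A * (√Real.pi / 2) := by
  rw [integral_norm_dotProduct_comp hA ha (f := fun x => x) measurable_id]
  rw [integral_const_mul, integral_norm_stdComplexNormal]

lemma integral_norm_dotProduct_sq {n : ℕ} {a : Fin n → ℂ} {A : ℝ} (hA : 0 ≤ A)
    (ha : a ⬝ᵥ star a = (A : ℂ) ^ 2) :
    ∫ u, ‖a ⬝ᵥ u‖ ^ 2 ∂stdComplexNormalVec n = A ^ 2 := by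
  rw [integral_norm_dotProduct_comp hA ha (f := fun x => x ^ 2) (by fun_prop)]
  simp only [mul_pow]
  rw [integral_const_mul, integral_norm_sq_stdComplexNormal, mul_one]

lemma dotProduct_star_self_eq_norm_sq {n : ℕ} (a : Fin n → ℂ) :
    a ⬝ᵥ star a = ((‖WithLp.toLp 2 a‖ ^ 2 : ℝ) : ℂ) := by
  rw [EuclideanSpace.norm_sq_eq, dotProduct, Complex.ofReal_sum]
  refine Finset.sum_congr rfl fun i _ => ?_
  rw [Pi.star_apply, RCLike.star_def, Complex.mul_conj, Complex.normSq_eq_norm_sq]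

lemma norm_toLp_eq_one {n : ℕ} {a : Fin n → ℂ} (ha : a ⬝ᵥ star a = 1) :
    ‖WithLp.toLp 2 a‖ = 1 := by
  rw [dotProduct_star_self_eq_norm_sq] at ha
  have h : ‖WithLp.toLp 2 a‖ ^ 2 = 1 := by exact_mod_cast ha
  exact (pow_eq_one_iff_of_nonneg (norm_nonneg _) two_ne_zero).1 h

lemma integral_norm_mul_norm_dotProduct {n : ℕ} {a b : Fin n → ℂ} (ha : a ⬝ᵥ star a = 1)
    (hb : b ⬝ᵥ star b = 1) :
    ∫ u, ‖a ⬝ᵥ u‖ * ‖b ⬝ᵥ u‖ ∂stdComplexNormalVec n = pairTerm (‖a ⬝ᵥ star b‖ ^ 2) := by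
  set c : ℂ := b ⬝ᵥ star a with hc
  have hab : a ⬝ᵥ star b = star c := by
    rw [hc, Matrix.dotProduct_star]
  have hc1 : ‖c‖ ≤ 1 := by
    -- Cauchy–Schwarz bounds the correlation by one.
    have h := norm_inner_le_norm (𝕜 := ℂ) (WithLp.toLp 2 a) (WithLp.toLp 2 b)
    rw [EuclideanSpace.inner_eq_star_dotProduct, norm_toLp_eq_one ha, norm_toLp_eq_one hb] at h
    simpa using h
  have hs : (√(1 - ‖c‖ ^ 2) : ℂ) * √(1 - ‖c‖ ^ 2) = 1 - c * star c := by
    rw [RCLike.star_def, Complex.mul_conj, Complex.normSq_eq_norm_sq, ← Complex.ofReal_mul,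
      Real.mul_self_sqrt (sub_nonneg.2 (pow_le_one₀ (norm_nonneg _) hc1))]
    push_cast
    ring
  -- Cholesky factorisation of the covariance of the pair; it remains valid when `‖c‖ = 1`.
  have hcov : Matrix.of ![a, b] * (Matrix.of ![a, b])ᴴ =
      !![1, 0; c, (√(1 - ‖c‖ ^ 2) : ℂ)] * (!![1, 0; c, (√(1 - ‖c‖ ^ 2) : ℂ)])ᴴ := by
    ext i j
    fin_cases i <;> fin_cases j
    · change a ⬝ᵥ star a = _
      simp [Matrix.mul_apply, ha]
    · change a ⬝ᵥ star b = _
      simp [Matrix.mul_apply, hab]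
    · change b ⬝ᵥ star a = _
      simp [Matrix.mul_apply, hc]
    · change b ⬝ᵥ star b = _
      rw [RCLike.star_def] at hs
      simp only [Matrix.mul_apply, Fin.sum_univ_two]
      simp [hb, hs]
  have h := integral_comp_mulVec_eq hcov (f := fun v => ‖v 0‖ * ‖v 1‖) (by fun_prop)
  refine h.trans ?_
  rw [hab, norm_star, ← pairMean_eq_pairTerm hc1, pairMean,
    ← (measurePreserving_finTwoArrow stdComplexNormal).integral_comp
      (MeasurableEquiv.measurableEmbedding _)]
  refine integral_congr_ae (ae_of_all _ fun v => ?_)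
  simp [Matrix.mulVec, dotProduct, MeasurableEquiv.finTwoArrow]

/-! ### Correlation matrices and their square roots. -/

lemma pairTerm_one : pairTerm 1 = 1 := by simp [pairTerm]

lemma sum_pairTerm_eq {N : ℕ} {R : Matrix (Fin N) (Fin N) ℂ} (hR : ∀ i, R i i = 1) :
    ∑ i, ∑ j, pairTerm (‖R i j‖ ^ 2) = N + sumF R := by
  have h : ∀ i j, pairTerm (‖R i j‖ ^ 2) =
      (if i = j then 1 else 0) + if i ≠ j then pairTerm (‖R i j‖ ^ 2) else 0 := by
    intro i j
    by_cases hij : i = j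
    · subst hij; simp [hR, pairTerm_one]
    · simp [hij]
  rw [sumF, Finset.sum_congr rfl fun i _ => Finset.sum_congr rfl fun j _ => h i j]
  simp [Finset.sum_add_distrib]

lemma IsCorrelationMatrix.sqrt_mul_conjTranspose {n : ℕ} {R : Matrix (Fin n) (Fin n) ℂ}
    (hR : IsCorrelationMatrix R) : CFC.sqrt R * (CFC.sqrt R)ᴴ = R := by
  have h : (CFC.sqrt R)ᴴ = CFC.sqrt R :=
    (Matrix.nonneg_iff_posSemidef.1 (CFC.sqrt_nonneg R)).isHermitian
  rw [h, CFC.sqrt_mul_sqrt_self R hR.posSemidef.nonneg]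

/-- The rows of `R^{1/2}` have Gram matrix `R`, so the channel entries, up to gain, are linear forms
with correlations `ρ_ij`. -/
lemma IsCorrelationMatrix.sqrt_row_dotProduct {n : ℕ} {R : Matrix (Fin n) (Fin n) ℂ}
    (hR : IsCorrelationMatrix R) (i j : Fin n) :
    CFC.sqrt R i ⬝ᵥ star (CFC.sqrt R j) = R i j := by
  conv_rhs => rw [← hR.sqrt_mul_conjTranspose]
  rfl

lemma normA_sq {M : ℕ} (R : Matrix (Fin M) (Fin M) ℂ) (a : Fin M → ℂ) :
    (star a ᵥ* CFC.sqrt R) ⬝ᵥ star (star a ᵥ* CFC.sqrt R) = (normA R a : ℂ) ^ 2 := by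
  have h : (CFC.sqrt R)ᴴ = CFC.sqrt R :=
    (Matrix.nonneg_iff_posSemidef.1 (CFC.sqrt_nonneg R)).isHermitian
  rw [Matrix.star_vecMul, star_star, h, normA, dotProduct_comm]
  have h2 : star a ᵥ* CFC.sqrt R = star (CFC.sqrt R *ᵥ a) := by
    rw [Matrix.star_mulVec, h]
  rw [h2, dotProduct_star_self_eq_norm_sq]
  push_cast
  rfl

/-! ### Optimality of the phases. -/

lemma re_star_dotProduct_self_eq_sum {n : ℕ} (v : Fin n → ℂ) :
    (star v ⬝ᵥ v).re = ∑ i, ‖v i‖ ^ 2 := by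
  rw [dotProduct_comm, dotProduct_star_self_eq_norm_sq, EuclideanSpace.norm_sq_eq, Complex.ofReal_re]

/-- The coefficient of `a_b` contributed by the reflected path. -/
def reflectedGain {N : ℕ} (ar hru : Fin N → ℂ) (φ : Fin N → ℝ) : ℂ :=
  ∑ n, star (ar n) * (Complex.exp (Complex.I * φ n) * hru n)

lemma globalChannel_losChannel {M N : ℕ} (β : ℝ) (hd ab : Fin M → ℂ) (ar hru : Fin N → ℂ)
    (φ : Fin N → ℝ) (i : Fin M) :
    globalChannel hd (losChannel β ab ar) hru φ i =
      hd i + (√β * reflectedGain ar hru φ) * ab i := by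
  rw [globalChannel, ← Matrix.mulVec_mulVec, Pi.add_apply, losChannel, Matrix.smul_mulVec,
    Matrix.vecMulVec_mulVec]
  simp [reflection, reflectedGain, dotProduct, Matrix.mulVec_diagonal]
  ring

lemma sum_norm_add_mul_sq {M : ℕ} (hd ab : Fin M → ℂ) (c : ℂ) :
    ∑ i, ‖hd i + c * ab i‖ ^ 2 = ∑ i, ‖hd i‖ ^ 2 + 2 * (star c * (star ab ⬝ᵥ hd)).re +
      ‖c‖ ^ 2 * ∑ i, ‖ab i‖ ^ 2 := by
  rw [dotProduct, Finset.mul_sum, Complex.re_sum, Finset.mul_sum, Finset.mul_sum,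
    ← Finset.sum_add_distrib, ← Finset.sum_add_distrib]
  refine Finset.sum_congr rfl fun i _ => ?_
  simp only [← Complex.normSq_eq_norm_sq, Complex.normSq_add, Pi.star_apply,
    RCLike.star_def, map_mul]
  rw [show hd i * (starRingEnd ℂ c * starRingEnd ℂ (ab i)) =
    starRingEnd ℂ c * (starRingEnd ℂ (ab i) * hd i) by ring]
  ring

lemma snr_losChannel {M N : ℕ} (τ β : ℝ) (hd : Fin M → ℂ) {ab : Fin M → ℂ}
    (hab : ‖WithLp.toLp 2 ab‖ = √(M : ℝ)) (ar hru : Fin N → ℂ) (φ : Fin N → ℝ) :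
    snr τ hd (losChannel β ab ar) hru φ =
      (∑ i, ‖hd i‖ ^ 2 + 2 * (star (√β * reflectedGain ar hru φ) * (star ab ⬝ᵥ hd)).re +
        ‖√β * reflectedGain ar hru φ‖ ^ 2 * M) * τ := by
  have hM : ∑ i, ‖ab i‖ ^ 2 = M := by
    have h := EuclideanSpace.norm_sq_eq (WithLp.toLp 2 ab)
    rw [hab, Real.sq_sqrt (Nat.cast_nonneg M)] at h
    exact h.symm
  simp_rw [snr, re_star_dotProduct_self_eq_sum, globalChannel_losChannel]
  rw [sum_norm_add_mul_sq, hM]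

/-- The SNR attained by coherent combining of all paths. -/
def coherentSnr {M N : ℕ} (τ β : ℝ) (ab hd : Fin M → ℂ) (hru : Fin N → ℂ) : ℝ :=
  (∑ i, ‖hd i‖ ^ 2 + 2 * (√β * ∑ n, ‖hru n‖) * ‖star ab ⬝ᵥ hd‖ +
    (√β * ∑ n, ‖hru n‖) ^ 2 * M) * τ

lemma norm_reflectedGain_le {N : ℕ} {ar : Fin N → ℂ} (har : ∀ n, ‖ar n‖ = 1) (hru : Fin N → ℂ)
    (φ : Fin N → ℝ) : ‖reflectedGain ar hru φ‖ ≤ ∑ n, ‖hru n‖ := by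
  refine (norm_sum_le _ _).trans (Finset.sum_le_sum fun n _ => ?_)
  rw [norm_mul, norm_mul, norm_star, har, mul_comm Complex.I, Complex.norm_exp_ofReal_mul_I,
    one_mul, one_mul]

lemma snr_le_coherentSnr {M N : ℕ} {τ : ℝ} (hτ : 0 ≤ τ) (β : ℝ) (hd : Fin M → ℂ)
    {ab : Fin M → ℂ} (hab : ‖WithLp.toLp 2 ab‖ = √(M : ℝ)) {ar : Fin N → ℂ}
    (har : ∀ n, ‖ar n‖ = 1) (hru : Fin N → ℂ) (φ : Fin N → ℝ) :
    snr τ hd (losChannel β ab ar) hru φ ≤ coherentSnr τ β ab hd hru := by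
  rw [snr_losChannel τ β hd hab, coherentSnr]
  have hc : ‖(√β : ℂ) * reflectedGain ar hru φ‖ ≤ √β * ∑ n, ‖hru n‖ := by
    rw [norm_mul, Complex.norm_real, Real.norm_of_nonneg (Real.sqrt_nonneg _)]
    exact mul_le_mul_of_nonneg_left (norm_reflectedGain_le har hru φ) (Real.sqrt_nonneg _)
  have hre : (star ((√β : ℂ) * reflectedGain ar hru φ) * (star ab ⬝ᵥ hd)).re ≤
      (√β * ∑ n, ‖hru n‖) * ‖star ab ⬝ᵥ hd‖ := by
    refine (Complex.re_le_norm _).trans ?_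
    rw [norm_mul, norm_star]
    exact mul_le_mul_of_nonneg_right hc (norm_nonneg _)
  have hsq := pow_le_pow_left₀ (norm_nonneg _) hc 2
  refine mul_le_mul_of_nonneg_right ?_ hτ
  have hM := mul_le_mul_of_nonneg_right hsq (Nat.cast_nonneg (α := ℝ) M)
  linarith

lemma reflectedGain_optimalPhases {M N : ℕ} (ab hd : Fin M → ℂ) {ar : Fin N → ℂ}
    (har : ∀ n, ‖ar n‖ = 1) (hru : Fin N → ℂ) :
    reflectedGain ar hru (optimalPhases ab ar hd hru) =
      (∑ n, ‖hru n‖ : ℝ) * Complex.exp ((star ab ⬝ᵥ hd).arg * Complex.I) := by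
  rw [reflectedGain, Complex.ofReal_sum, Finset.sum_mul]
  refine Finset.sum_congr rfl fun n _ => ?_
  have h1 : star (ar n) * Complex.exp ((ar n).arg * Complex.I) = 1 := by
    have h := Complex.norm_mul_exp_arg_mul_I (ar n)
    rw [har, Complex.ofReal_one, one_mul] at h
    rw [h, RCLike.star_def, Complex.conj_mul', har]
    simp
  -- Also valid for `hru n = 0`, where both sides vanish.
  have h2 : Complex.exp (-((hru n).arg * Complex.I)) * hru n = ‖hru n‖ := by
    nth_rewrite 2 [← Complex.norm_mul_exp_arg_mul_I (hru n)]
    rw [mul_left_comm, ← Complex.exp_add, neg_add_cancel, Complex.exp_zero, mul_one]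
  have h3 : Complex.I * (optimalPhases ab ar hd hru n : ℂ) =
      (star ab ⬝ᵥ hd).arg * Complex.I + (ar n).arg * Complex.I + -((hru n).arg * Complex.I) := by
    rw [optimalPhases]
    push_cast
    ring
  rw [h3, Complex.exp_add, Complex.exp_add, ← h2]
  linear_combination (Complex.exp ((star ab ⬝ᵥ hd).arg * Complex.I) *
    (Complex.exp (-((hru n).arg * Complex.I)) * hru n)) * h1

lemma snr_optimalPhases {M N : ℕ} (τ β : ℝ) (hd : Fin M → ℂ) {ab : Fin M → ℂ}
    (hab : ‖WithLp.toLp 2 ab‖ = √(M : ℝ)) {ar : Fin N → ℂ} (har : ∀ n, ‖ar n‖ = 1)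
    (hru : Fin N → ℂ) :
    snr τ hd (losChannel β ab ar) hru (optimalPhases ab ar hd hru) =
      coherentSnr τ β ab hd hru := by
  rw [snr_losChannel τ β hd hab, coherentSnr, reflectedGain_optimalPhases ab hd har]
  set z := star ab ⬝ᵥ hd
  set S := ∑ n, ‖hru n‖
  have hS : 0 ≤ S := Finset.sum_nonneg fun n _ => norm_nonneg _
  have hnorm : ‖(√β : ℂ) * (S * Complex.exp (z.arg * Complex.I))‖ = √β * S := by
    rw [norm_mul, norm_mul, Complex.norm_exp_ofReal_mul_I, mul_one, Complex.norm_real,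
      Complex.norm_real, Real.norm_of_nonneg (Real.sqrt_nonneg _), Real.norm_of_nonneg hS]
  have hre : star ((√β : ℂ) * (S * Complex.exp (z.arg * Complex.I))) * z =
      ((√β * S * ‖z‖ : ℝ) : ℂ) := by
    have he : star (Complex.exp (z.arg * Complex.I)) * Complex.exp (z.arg * Complex.I) = 1 := by
      rw [RCLike.star_def, Complex.conj_mul', Complex.norm_exp_ofReal_mul_I]
      simp
    nth_rewrite 2 [← Complex.norm_mul_exp_arg_mul_I z]
    simp only [star_mul', RCLike.star_def, Complex.conj_ofReal] at he ⊢
    push_cast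
    linear_combination (√β * S * ‖z‖ : ℂ) * he
  rw [hnorm, hre, Complex.ofReal_re]
  ring

/-! ### The expectation. -/

variable {Ω : Type*} [MeasurableSpace Ω] {P : Measure Ω}

lemma memLp_norm_dotProduct_comp {n : ℕ} {u : Ω → Fin n → ℂ}
    (hu : HasLaw u (stdComplexNormalVec n) P) (a : Fin n → ℂ) :
    MemLp (fun ω => ‖a ⬝ᵥ u ω‖) 2 P :=
  MemLp.comp_of_map (g := fun v => ‖a ⬝ᵥ v‖) (hu.map_eq ▸ (memLp_two_dotProduct a).norm)
    hu.aemeasurable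

lemma coherentSnr_rayleigh {M N : ℕ} {βd βbr βru : ℝ} (hβd : 0 ≤ βd) (hβru : 0 ≤ βru)
    (hβbr : 0 ≤ βbr) (τ : ℝ) (Rd : Matrix (Fin M) (Fin M) ℂ) (Rru : Matrix (Fin N) (Fin N) ℂ)
    (ab u : Fin M → ℂ) (v : Fin N → ℂ) :
    coherentSnr τ βbr ab (rayleighChannel βd Rd u) (rayleighChannel βru Rru v) =
      (βd * ∑ i, ‖CFC.sqrt Rd i ⬝ᵥ u‖ ^ 2 +
        2 * (√βd * √βbr * √βru) *
          ∑ n, ‖(star ab ᵥ* CFC.sqrt Rd) ⬝ᵥ u‖ * ‖CFC.sqrt Rru n ⬝ᵥ v‖ +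
        βbr * βru * M * ∑ i, ∑ j, ‖CFC.sqrt Rru i ⬝ᵥ v‖ * ‖CFC.sqrt Rru j ⬝ᵥ v‖) * τ := by
  have hray : ∀ {n : ℕ} (β : ℝ) (R : Matrix (Fin n) (Fin n) ℂ) (w : Fin n → ℂ) (i : Fin n),
      ‖rayleighChannel β R w i‖ = √β * ‖CFC.sqrt R i ⬝ᵥ w‖ := by
    intro n β R w i
    rw [rayleighChannel, Pi.smul_apply, norm_smul, Real.norm_of_nonneg (Real.sqrt_nonneg _)]
    rfl
  have hz : ‖star ab ⬝ᵥ rayleighChannel βd Rd u‖ = √βd * ‖(star ab ᵥ* CFC.sqrt Rd) ⬝ᵥ u‖ := by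
    rw [rayleighChannel, dotProduct_smul, norm_smul, Real.norm_of_nonneg (Real.sqrt_nonneg _),
      Matrix.dotProduct_mulVec]
  simp_rw [coherentSnr, hray, hz, mul_pow, Real.sq_sqrt hβd, ← Finset.mul_sum,
    ← Finset.sum_mul, mul_pow, Real.sq_sqrt hβbr, Real.sq_sqrt hβru]
  ring

lemma integrable_and_integral_coherentSnr [IsProbabilityMeasure P] {M N : ℕ} {βd βbr βru : ℝ}
    (hβd : 0 ≤ βd) (hβbr : 0 ≤ βbr) (hβru : 0 ≤ βru) (τ : ℝ)
    {Rd : Matrix (Fin M) (Fin M) ℂ} (hRd : IsCorrelationMatrix Rd)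
    {Rru : Matrix (Fin N) (Fin N) ℂ} (hRru : IsCorrelationMatrix Rru) (ab : Fin M → ℂ)
    {ud : Ω → Fin M → ℂ} {uru : Ω → Fin N → ℂ} (hud : HasLaw ud (stdComplexNormalVec M) P)
    (huru : HasLaw uru (stdComplexNormalVec N) P) (hindep : IndepFun ud uru P) :
    Integrable (fun ω => coherentSnr τ βbr ab (rayleighChannel βd Rd (ud ω))
      (rayleighChannel βru Rru (uru ω))) P ∧
    ∫ ω, coherentSnr τ βbr ab (rayleighChannel βd Rd (ud ω))
      (rayleighChannel βru Rru (uru ω)) ∂P =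
      (βd * M + N * normA Rd ab * Real.pi * √(βd * βbr * βru) / 2
        + βbr * βru * M * (N + sumF Rru)) * τ := by
  simp_rw [coherentSnr_rayleigh hβd hβru hβbr]
  have hdiag : ∀ {n : ℕ} {R : Matrix (Fin n) (Fin n) ℂ}, IsCorrelationMatrix R → ∀ i,
      CFC.sqrt R i ⬝ᵥ star (CFC.sqrt R i) = 1 :=
    fun hR i => (hR.sqrt_row_dotProduct i i).trans (hR.diag_eq_one i)
  have hdiag' : ∀ {n : ℕ} {R : Matrix (Fin n) (Fin n) ℂ}, IsCorrelationMatrix R → ∀ i,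
      CFC.sqrt R i ⬝ᵥ star (CFC.sqrt R i) = ((1 : ℝ) : ℂ) ^ 2 :=
    fun hR i => by rw [hdiag hR]; simp
  have hi1 : ∀ i, Integrable (fun ω => ‖CFC.sqrt Rd i ⬝ᵥ ud ω‖ ^ 2) P :=
    fun i => (memLp_norm_dotProduct_comp hud _).integrable_sq
  have hi3 : ∀ i j, Integrable
      (fun ω => ‖CFC.sqrt Rru i ⬝ᵥ uru ω‖ * ‖CFC.sqrt Rru j ⬝ᵥ uru ω‖) P :=
    fun i j => (memLp_norm_dotProduct_comp huru _).integrable_mul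
      (memLp_norm_dotProduct_comp huru _)
  have hi2 : ∀ n, Integrable
      (fun ω => ‖(star ab ᵥ* CFC.sqrt Rd) ⬝ᵥ ud ω‖ * ‖CFC.sqrt Rru n ⬝ᵥ uru ω‖) P :=
    fun n => (memLp_norm_dotProduct_comp hud _).integrable_mul
      (memLp_norm_dotProduct_comp huru _)
  have he1 : ∀ i, ∫ ω, ‖CFC.sqrt Rd i ⬝ᵥ ud ω‖ ^ 2 ∂P = 1 := fun i => by
    refine (hud.integral_comp (f := fun u => ‖CFC.sqrt Rd i ⬝ᵥ u‖ ^ 2)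
      (Measurable.aestronglyMeasurable (by fun_prop))).trans ?_
    rw [integral_norm_dotProduct_sq zero_le_one (hdiag' hRd i), one_pow]
  have he3 : ∀ i j, ∫ ω, ‖CFC.sqrt Rru i ⬝ᵥ uru ω‖ * ‖CFC.sqrt Rru j ⬝ᵥ uru ω‖ ∂P =
      pairTerm (‖Rru i j‖ ^ 2) := fun i j => by
    refine (huru.integral_comp
      (f := fun u => ‖CFC.sqrt Rru i ⬝ᵥ u‖ * ‖CFC.sqrt Rru j ⬝ᵥ u‖)
      (Measurable.aestronglyMeasurable (by fun_prop))).trans ?_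
    rw [integral_norm_mul_norm_dotProduct (hdiag hRru i) (hdiag hRru j),
      hRru.sqrt_row_dotProduct]
  have he2 : ∀ n, ∫ ω, ‖(star ab ᵥ* CFC.sqrt Rd) ⬝ᵥ ud ω‖ * ‖CFC.sqrt Rru n ⬝ᵥ uru ω‖ ∂P =
      normA Rd ab * (√Real.pi / 2) * (√Real.pi / 2) := fun n => by
    have hind := hindep.comp (φ := fun u => ‖(star ab ᵥ* CFC.sqrt Rd) ⬝ᵥ u‖)
      (ψ := fun u => ‖CFC.sqrt Rru n ⬝ᵥ u‖) (by fun_prop) (by fun_prop)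
    refine (hind.integral_mul_eq_mul_integral
      (memLp_norm_dotProduct_comp hud _).aestronglyMeasurable
      (memLp_norm_dotProduct_comp huru _).aestronglyMeasurable).trans ?_
    rw [hud.integral_comp (Measurable.aestronglyMeasurable (by fun_prop)),
      huru.integral_comp (Measurable.aestronglyMeasurable (by fun_prop)),
      integral_norm_dotProduct (A := normA Rd ab) (norm_nonneg _) (normA_sq Rd ab),
      integral_norm_dotProduct zero_le_one (hdiag' hRru n), one_mul]
  have hI1 := (integrable_finsetSum Finset.univ fun i _ => hi1 i).const_mul βd
  have hI2 := (integrable_finsetSum Finset.univ fun i _ => hi2 i).const_mul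
    (2 * (√βd * √βbr * √βru))
  have hI3 := (integrable_finsetSum Finset.univ fun i _ =>
    integrable_finsetSum Finset.univ fun j _ => hi3 i j).const_mul (βbr * βru * M)
  refine ⟨((hI1.add hI2).add hI3).mul_const τ, ?_⟩
  rw [integral_mul_const, integral_add (hI1.fun_add hI2) hI3, integral_add hI1 hI2,
    integral_const_mul, integral_const_mul, integral_const_mul,
    integral_finsetSum _ fun i _ => hi1 i, integral_finsetSum _ fun i _ => hi2 i,
    integral_finsetSum _ fun i _ => integrable_finsetSum Finset.univ fun j _ => hi3 i j]
  simp_rw [integral_finsetSum Finset.univ fun j _ => hi3 _ j, he1, he2, he3]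
  rw [sum_pairTerm_eq hRru.diag_eq_one, Real.sqrt_mul (by positivity), Real.sqrt_mul hβd]
  simp only [Finset.sum_const, Finset.card_univ, Fintype.card_fin, nsmul_eq_mul, mul_one]
  -- The cross term carries `2 · (√π/2)² = π/2`.
  have hpi : √Real.pi ^ 2 = Real.pi := Real.sq_sqrt Real.pi_pos.le
  linear_combination (√βd * √βbr * √βru * N * normA Rd ab / 2 * τ) * hpi

end RIS

end

theorem theorem1 {Ω : Type*} [MeasurableSpace Ω] (P : Measure Ω) [IsProbabilityMeasure P]
    (M N : ℕ)
    (βd βbr βru : ℝ) (hβd : 0 ≤ βd) (hβbr : 0 ≤ βbr) (hβru : 0 ≤ βru)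
    (Es σ τ : ℝ) (hEs : 0 ≤ Es) (hσ : 0 < σ) (hτ : τ = Es / σ ^ 2)
    (Rd : Matrix (Fin M) (Fin M) ℂ) (hRd : RIS.IsCorrelationMatrix Rd)
    (Rru : Matrix (Fin N) (Fin N) ℂ) (hRru : RIS.IsCorrelationMatrix Rru)
    (ab : Fin M → ℂ) (hab : ‖WithLp.toLp 2 ab‖ = √(M : ℝ))
    (ar : Fin N → ℂ) (har : ∀ n, ‖ar n‖ = 1)
    (ud : Ω → Fin M → ℂ) (uru : Ω → Fin N → ℂ)
    (hud : HasLaw ud (RIS.stdComplexNormalVec M) P)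
    (huru : HasLaw uru (RIS.stdComplexNormalVec N) P)
    (hindep : IndepFun ud uru P)
    (hd : Ω → Fin M → ℂ) (hhd : ∀ ω, hd ω = RIS.rayleighChannel βd Rd (ud ω))
    (hru : Ω → Fin N → ℂ) (hhru : ∀ ω, hru ω = RIS.rayleighChannel βru Rru (uru ω))
    (Hbr : Matrix (Fin M) (Fin N) ℂ) (hHbr : Hbr = RIS.losChannel βbr ab ar)
    (SNR : Ω → ℝ)
    (hSNR : ∀ ω, SNR ω =
      RIS.snr τ (hd ω) Hbr (hru ω) (RIS.optimalPhases ab ar (hd ω) (hru ω))) :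
    (∀ (ω : Ω) (φ : Fin N → ℝ), RIS.snr τ (hd ω) Hbr (hru ω) φ ≤ SNR ω) ∧
    Tendsto RIS.pairFormula (𝓝[<] 1) (𝓝 1) ∧
    Integrable SNR P ∧
    ∫ ω, SNR ω ∂P =
      (βd * M + N * RIS.normA Rd ab * Real.pi * √(βd * βbr * βru) / 2
        + βbr * βru * M * (N + RIS.sumF Rru)) * τ := by
  have hτ0 : 0 ≤ τ := hτ ▸ div_nonneg hEs (sq_nonneg σ)
  have hcoh : ∀ ω, SNR ω = RIS.coherentSnr τ βbr ab (RIS.rayleighChannel βd Rd (ud ω))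
      (RIS.rayleighChannel βru Rru (uru ω)) := fun ω => by
    rw [hSNR, hHbr, RIS.snr_optimalPhases τ βbr (hd ω) hab har, hhd, hhru]
  obtain ⟨hint, hval⟩ := RIS.integrable_and_integral_coherentSnr hβd hβbr hβru τ hRd hRru ab
    hud huru hindep
  refine ⟨fun ω φ => ?_, RIS.tendsto_pairFormula, ?_, ?_⟩
  · rw [hcoh, hHbr, ← hhd, ← hhru]
    exact RIS.snr_le_coherentSnr hτ0 βbr (hd ω) hab har (hru ω) φ
  · rw [funext hcoh]
    exact hint
  · simp_rw [hcoh]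
    exact hval
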